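/- Let $\mathbb{F}$ be an algebraically closed field of characteristic different from $2$ and let $m\ge 2$ be an integer. For $i=1,2$ let $L_i(X)=f_i(t)+g_i(t)X$ with $f_i,g_i\in\mathbb{F}[t]$, $g_i\neq 0$, be a linear function over $\mathbb{F}[t]$ that is primitive, i.e. $\gcd(f_i,g_i)=1$, and such that $\deg f_i>\deg g_i+m$. Assume that $L_1$ and $L_2$ are distinct up to constant factors, i.e. $L_2\neq cL_1$ for all $c\in\mathbb{F}^\times$. Let $A_0,\dots,A_m$ be independent variables over $\mathbb{F}$, let $h=\sum_{j=0}^m A_jt^j$, and let $d_i=\operatorname{disc}_t(L_i(h))$ be the discriminant of $L_i(h)=f_i(t)+g_i(t)h(t)$ regarded as a polynomial in $t$. Then $d_1$ and $d_2$ are not squares in the ring $\mathbb{F}(A_1,\dots,A_m)[A_0]$, and they are relatively prime in this ring. -/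

import Mathlib

open Polynomial

noncomputable section

/-- The rational function field `F(A₁, …, A_m)`; the variable `A_{j+1}` is indexed by `j : Fin m`. -/
abbrev CoeffField (F : Type*) [Field F] (m : ℕ) : Type _ :=
  FractionRing (MvPolynomial (Fin m) F)

/-- The ring `F(A₁, …, A_m)[A₀]`; the variable `A₀` is `Polynomial.X`. -/
abbrev CoeffRing (F : Type*) [Field F] (m : ℕ) : Type _ :=
  Polynomial (CoeffField F m)

/-- The variable `A_j` as an element of `F(A₁, …, A_m)[A₀]`, for `0 ≤ j ≤ m`. -/
def genericCoeff (F : Type*) [Field F] (m : ℕ) : Fin (m + 1) → CoeffRing F m :=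
  Fin.cons X fun j : Fin m =>
    C (algebraMap (MvPolynomial (Fin m) F) (CoeffField F m) (MvPolynomial.X j))

/-- The generic polynomial `h = ∑_{j=0}^m A_j t^j`, a polynomial in `t` over
`F(A₁, …, A_m)[A₀]`. -/
def genericPoly (F : Type*) [Field F] (m : ℕ) : Polynomial (CoeffRing F m) :=
  ∑ j : Fin (m + 1), C (genericCoeff F m j) * X ^ (j : ℕ)

/-- A linear function `L(X) = f(t) + g(t) X` over `F[t]`, with `g ≠ 0`. -/
structure LinearFunction (F : Type*) [Field F] where
  f : Polynomial F
  g : Polynomial F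
  g_ne_zero : g ≠ 0

namespace LinearFunction

variable {F : Type*} [Field F]

/-- `L = f + g X` is primitive if `gcd(f, g) = 1`. -/
def IsPrimitive (L : LinearFunction F) : Prop := IsCoprime L.f L.g

/-- `L₁` and `L₂` are proportional if `L₂ = c L₁` for some nonzero constant `c ∈ F`. -/
def Proportional (L₁ L₂ : LinearFunction F) : Prop :=
  ∃ c : F, c ≠ 0 ∧ L₂.f = C c * L₁.f ∧ L₂.g = C c * L₁.g

/-- `L(h) = f(t) + g(t) h(t)` for a polynomial `h` in `t` over an `F`-algebra `R`. -/
def evalAt {R : Type*} [CommRing R] [Algebra F R] (L : LinearFunction F) (h : Polynomial R) :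
    Polynomial R :=
  L.f.map (algebraMap F R) + L.g.map (algebraMap F R) * h

/-- The discriminant in `t` of `L(h)`, for the generic polynomial `h` of degree `m`. -/
def genericDiscr (L : LinearFunction F) (m : ℕ) : CoeffRing F m :=
  (L.evalAt (genericPoly F m)).discr

end LinearFunction

end

/-! Write u = A₁t + ⋯ + A_m t^m, so that L(h) = f + g(u + A₀), over the algebraic closure of F(A₁,
…, A_m). Let W = f'g − fg' + g²u', the numerator of (f/g + u)'. Since g·L(h)' = W + g'·L(h) and
Res(f, g) is a unit, the discriminant is, up to a unit, the product of the values of L(h) at the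
roots ρ of W (`discr_associated_prod_roots`). If g(ρ) = 0, the factor is the nonzero constant f(ρ);
otherwise it is linear in A₀, with root −(f/g + u)(ρ), minus a critical value.

A critical value determines its critical point, even across different L
(`critical_point_eq_of_value_eq`): extend ∂/∂A₁ to the separable closure; since the t-derivative
vanishes at a critical point τ, the critical value there has derivative τ.

Counting transcendence degrees shows that critical points with g ≠ 0 exist, are simple roots of W
(here characteristic ≠ 2 enters) and are transcendental over F. So each discriminant has a simple
root and is not a square. A common root of d₁ and d₂ gives a common critical point τ where f₁/g₁ =
f₂/g₂; as τ is transcendental, this is an identity, and primitivity makes L₁ and L₂ proportional. -/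

/-! ### Transcendence degree bounds. -/

theorem trdeg_intermediateField_adjoin_le {F E : Type*} [Field F] [Field E] [Algebra F E]
    (s : Finset E) : Algebra.trdeg F (IntermediateField.adjoin F (s : Set E)) ≤ s.card := by
  open scoped IntermediateField.algebraAdjoinAdjoin in
  rw [← trdeg_add_eq F (Algebra.adjoin F (s : Set E)),
    trdeg_eq_zero (R := Algebra.adjoin F (s : Set E)), add_zero]
  let t : Set (Algebra.adjoin F (s : Set E)) := Subtype.val ⁻¹' (s : Set E)
  have ht : Algebra.adjoin F t = ⊤ := Algebra.adjoin_adjoin_coe_preimage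
  have : Algebra.IsAlgebraic (Algebra.adjoin F t) (Algebra.adjoin F (s : Set E)) :=
    ⟨fun x => isAlgebraic_algebraMap (⟨x, by rw [ht]; trivial⟩ : Algebra.adjoin F t)⟩
  refine (Algebra.IsAlgebraic.trdeg_le_cardinalMk F t).trans ?_
  rw [← Cardinal.mk_coe_finset]
  refine Cardinal.mk_le_of_injective (f := fun x : t => (⟨x.1.1, x.2⟩ : s)) ?_
  rintro ⟨⟨x, _⟩, _⟩ ⟨⟨y, _⟩, _⟩ h
  simpa using h

theorem AlgebraicIndependent.card_le_of_mem_adjoin {F E ι : Type*} [Field F] [Field E] [Algebra F E]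
    [Fintype ι] {x : ι → E} (hx : AlgebraicIndependent F x) (s : Finset E)
    (h : ∀ i, x i ∈ IntermediateField.adjoin F (s : Set E)) : Fintype.card ι ≤ s.card := by
  let M := IntermediateField.adjoin F (s : Set E)
  have hy : AlgebraicIndependent F (fun i => (⟨x i, h i⟩ : M)) :=
    AlgebraicIndependent.of_comp M.val hx
  have h1 := hy.lift_cardinalMk_le_trdeg.trans
    (Cardinal.lift_le.2 (trdeg_intermediateField_adjoin_le (F := F) s))
  simpa using h1

theorem IsAlgebraic.mem_range_algebraMap {F E : Type*} [Field F] [IsAlgClosed F] [Field E]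
    [Algebra F E] {s : E} (hs : IsAlgebraic F s) : s ∈ (algebraMap F E).range := by
  have := IntermediateField.isAlgebraic_adjoin_simple hs.isIntegral
  have h := IntermediateField.mem_adjoin_simple_self F s
  rw [IntermediateField.eq_bot_of_isAlgClosed_of_isAlgebraic (IntermediateField.adjoin F {s})] at h
  exact IntermediateField.mem_bot.1 h

/-! ### Derivations and critical values. -/

/-- Every assignment of values to the variables extends to a derivation on a formally étale
algebra over a polynomial ring. -/
theorem MvPolynomial.exists_derivation_of_formallyEtale {F σ T : Type*} [CommRing F] [CommRing T]
    [Algebra F T] [Algebra (MvPolynomial σ F) T] [IsScalarTower F (MvPolynomial σ F) T]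
    [Algebra.FormallyEtale (MvPolynomial σ F) T] (v : σ → T) :
    ∃ D : Derivation F T T, ∀ i, D (algebraMap (MvPolynomial σ F) T (X i)) = v i := by
  let D₀ : Derivation F (MvPolynomial σ F) T := MvPolynomial.mkDerivation F v
  let l := (LinearMap.liftBaseChange T D₀.liftKaehlerDifferential) ∘ₗ
    (KaehlerDifferential.tensorKaehlerEquivOfFormallyEtale F (MvPolynomial σ F) T).symm.toLinearMap
  refine ⟨l.compDer (KaehlerDifferential.D F T), fun i => ?_⟩
  change l (KaehlerDifferential.D F T (algebraMap (MvPolynomial σ F) T (X i))) = v i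
  rw [LinearMap.comp_apply, LinearEquiv.coe_coe,
    KaehlerDifferential.tensorKaehlerEquivOfFormallyEtale_symm_D_algebraMap]
  simp [D₀, MvPolynomial.mkDerivation_X]

/-- The derivative of a root: if `f + g (u + α)` vanishes at a critical point `τ` of `f / g + u`,
then `α` moves with velocity `-τ` under a derivation `D` whose action on the coefficients of `u`
sends `u` to the polynomial `X`. -/
theorem Derivation.apply_eq_neg_of_critical {F T : Type*} [Field F] [Field T] [Algebra F T]
    (D : Derivation F T T) {m : ℕ} (a : Fin (m + 1) → T) (h0 : D (a 0) = 1)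
    (hs : ∀ j : Fin m, D (a j.succ) = 0) (f g : F[X]) (τ α : T) (hg : aeval τ g ≠ 0)
    (hP : aeval τ f + aeval τ g * (∑ j, a j * τ ^ (j.1 + 1) + α) = 0)
    (hW : aeval τ (derivative f) * aeval τ g - aeval τ f * aeval τ (derivative g) +
      aeval τ g ^ 2 * ∑ j, (j.1 + 1) * a j * τ ^ j.1 = 0) :
    D α = -τ := by
  have hD : D (∑ j, a j * τ ^ (j.1 + 1)) = τ + (∑ j, (j.1 + 1) * a j * τ ^ j.1) * D τ := by
    simp only [map_sum, Derivation.leibniz, Derivation.leibniz_pow, Finset.sum_add_distrib]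
    rw [add_comm]
    congr 1
    · rw [Fin.sum_univ_succ]
      simp [h0, hs]
    · rw [Finset.sum_mul]
      refine Finset.sum_congr rfl fun j _ => ?_
      simp
      ring
  have h1 := congrArg D hP
  simp only [map_add, Derivation.leibniz, hD, map_zero] at h1
  rw [D.map_aeval, D.map_aeval] at h1
  simp only [smul_eq_mul] at h1
  set S := ∑ j, a j * τ ^ (j.1 + 1)
  set S' := ∑ j, (j.1 + 1) * a j * τ ^ j.1
  -- After multiplying by g(τ), the coefficient of D τ is W(τ) plus g'(τ) times the left side of
  -- `hP`; both vanish.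
  have : aeval τ g ^ 2 * (D α + τ) = 0 := by
    linear_combination (aeval τ g) * h1 - D τ * hW - D τ * aeval τ (derivative g) * hP
  exact eq_neg_of_add_eq_zero_left
    ((mul_eq_zero.1 this).resolve_left (pow_ne_zero 2 hg))

/-! ### The discriminant as a product over critical points. -/

/-- The numerator `f' g - f g' + g² u'` of the derivative of `f / g + u`. -/
noncomputable def criticalPoly {R : Type*} [CommRing R] (f g u : R[X]) : R[X] :=
  derivative f * g - f * derivative g + g ^ 2 * derivative u

theorem criticalPoly_map {R S : Type*} [CommRing R] [CommRing S] (φ : R →+* S) (f g u : R[X]) :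
    criticalPoly (f.map φ) (g.map φ) (u.map φ) = (criticalPoly f g u).map φ := by
  simp [criticalPoly, derivative_map]

/-- Each extra unit of formal degree for `q` multiplies the resultant by the coefficient `p.coeff
m`, up to sign. -/
theorem resultant_associated_of_natDegree_le {R : Type*} [CommRing R] (p q : R[X]) (m n : ℕ)
    (hp : IsUnit (p.coeff m)) (hq : q.natDegree ≤ n) :
    Associated (resultant p q m) (resultant p q m n) := by
  obtain ⟨k, rfl⟩ := Nat.exists_eq_add_of_le hq
  rw [resultant_add_right_deg _ _ _ _ _ le_rfl]
  exact (associated_unit_mul_left _ _ (hp.pow k)).symm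

theorem resultant_comm_associated {R : Type*} [CommRing R] (p q : R[X]) (m n : ℕ) :
    Associated (resultant p q m n) (resultant q p n m) := by
  rw [resultant_comm]
  exact associated_unit_mul_left _ _ (isUnit_one.neg.pow _)

section
variable {R : Type*} [CommRing R]

theorem natDegree_add_mul_of_lt {f g q : R[X]} (h : g.natDegree + q.natDegree < f.natDegree) :
    (f + g * q).natDegree = f.natDegree :=
  natDegree_add_eq_left_of_natDegree_lt (natDegree_mul_le.trans_lt h)

theorem leadingCoeff_add_mul_of_lt {f g q : R[X]} (h : g.natDegree + q.natDegree < f.natDegree) :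
    (f + g * q).leadingCoeff = f.leadingCoeff := by
  rw [leadingCoeff, natDegree_add_mul_of_lt h, coeff_add,
    coeff_eq_zero_of_natDegree_lt (natDegree_mul_le.trans_lt h), add_zero, leadingCoeff]

/-- If `c` is a constant, the discriminant of `f + g (u + c)` is, up to a unit, the resultant of
this polynomial with the numerator of the derivative of `f / g + u`. -/
theorem discr_associated_resultant_criticalPoly (f g u : R[X]) (c : R)
    (hdeg : g.natDegree + u.natDegree < f.natDegree) (hlc : IsUnit f.leadingCoeff)
    (hres : IsUnit (resultant f g)) :
    Associated (f + g * (u + C c)).discr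
      (resultant (criticalPoly f g u) (f + g * (u + C c)) (criticalPoly f g u).natDegree
        f.natDegree) := by
  have hdeg' : g.natDegree + (u + C c).natDegree < f.natDegree := by
    rwa [natDegree_add_C]
  set P := f + g * (u + C c) with hP
  have hn : P.natDegree = f.natDegree := natDegree_add_mul_of_lt hdeg'
  have hl : P.leadingCoeff = f.leadingCoeff := leadingCoeff_add_mul_of_lt hdeg'
  have hu : IsUnit (P.coeff f.natDegree) := by rwa [← hn, coeff_natDegree, hl]
  have hpos : 0 < P.degree := natDegree_pos_iff_degree_pos.1 (by omega)
  have hPg : resultant P g f.natDegree = resultant f g :=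
    resultant_add_mul_left _ _ _ _ _ (by omega) le_rfl
  have hid : g * derivative P = criticalPoly f g u + P * derivative g := by
    simp only [hP, criticalPoly, derivative_add, derivative_mul, derivative_C]
    ring
  have h1 : Associated P.discr (resultant P (derivative P) f.natDegree) := by
    have h := resultant_deriv hpos
    rw [hn, hl] at h
    -- In positive characteristic `derivative P` may have degree below `f.natDegree - 1`; the formal
    -- degree absorbs the gap.
    refine Associated.trans ?_ (resultant_associated_of_natDegree_le P (derivative P) f.natDegree
      (f.natDegree - 1) hu (by rw [← hn]; exact natDegree_derivative_le P)).symm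
    rw [h]
    exact (associated_unit_mul_left _ _ ((isUnit_one.neg.pow _).mul hlc)).symm
  refine h1.trans ?_
  have h2 := resultant_mul_right P g (derivative P) f.natDegree hn.le
  rw [hPg] at h2
  have h3 : Associated (resultant P (derivative P) f.natDegree)
      (resultant P (g * derivative P) f.natDegree) := by
    refine (associated_unit_mul_left _ _ hres).symm.trans ?_
    rw [← h2]
    exact (resultant_associated_of_natDegree_le _ _ _ _ hu natDegree_mul_le).symm
  refine h3.trans ?_
  -- Any formal degree large enough for all the polynomials involved allows the multiple of `P` to
  -- be dropped.
  set N := (g * derivative P).natDegree + (criticalPoly f g u).natDegree +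
    (derivative g).natDegree + f.natDegree with hN
  refine (resultant_associated_of_natDegree_le _ _ _ N hu (by omega)).trans ?_
  rw [hid, resultant_add_mul_right _ _ _ _ _ (by omega) hn.le]
  refine (resultant_associated_of_natDegree_le _ _ _ N hu (by omega)).symm.trans ?_
  exact resultant_comm_associated _ _ _ _
end

/-- The discriminant of `f + g (u + X)`, with `X` a new variable, is up to a unit the product of
the values of this polynomial at the critical points of `f / g + u`. -/
theorem discr_associated_prod_roots {E : Type*} [Field E] [IsAlgClosed E] (f g u : E[X])
    (hfg : IsCoprime f g) (hdeg : g.natDegree + u.natDegree < f.natDegree)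
    (hW : criticalPoly f g u ≠ 0) :
    Associated (f.map C + g.map C * (u.map C + C X) : E[X][X]).discr
      ((criticalPoly f g u).roots.map fun ρ =>
        C (f.eval ρ + g.eval ρ * u.eval ρ) + C (g.eval ρ) * X).prod := by
  have hf : f ≠ 0 := by rintro rfl; simp at hdeg
  have hnat : ∀ p : E[X], (p.map (C : E →+* E[X])).natDegree = p.natDegree := fun p =>
    natDegree_map_eq_of_injective C_injective p
  have hlead : ∀ p : E[X], (p.map (C : E →+* E[X])).leadingCoeff = C p.leadingCoeff := fun p =>
    leadingCoeff_map_of_injective C_injective p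
  have hdeg' : (g.map (C : E →+* E[X])).natDegree + (u.map (C : E →+* E[X])).natDegree <
      (f.map (C : E →+* E[X])).natDegree := by
    rwa [hnat, hnat, hnat]
  have hlc : IsUnit (f.map (C : E →+* E[X])).leadingCoeff := by
    rw [hlead, isUnit_C]
    exact (leadingCoeff_ne_zero.2 hf).isUnit
  have hres : IsUnit (resultant (f.map (C : E →+* E[X])) (g.map (C : E →+* E[X]))) := by
    rw [hnat, hnat, resultant_map_map, isUnit_C]
    exact (resultant_ne_zero f g hfg).isUnit
  have h1 := discr_associated_resultant_criticalPoly _ _ _ X hdeg' hlc hres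
  refine h1.trans ?_
  generalize hW' : criticalPoly f g u = W at hW
  have hsp : W.Splits := IsAlgClosed.splits _
  have hP : (f.map C + g.map C * (u.map C + C X) : E[X][X]).natDegree ≤
      (f.map (C : E →+* E[X])).natDegree := by
    rw [natDegree_add_mul_of_lt (by rwa [natDegree_add_C])]
  rw [criticalPoly_map, hW', resultant_eq_prod_eval _ _ _ hP (hsp.map C), hlead]
  refine (associated_unit_mul_left _ _
    ((isUnit_C.2 (leadingCoeff_ne_zero.2 hW).isUnit).pow _)).trans ?_
  rw [hsp.roots_map_of_injective C_injective, Multiset.map_map]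
  refine Associated.of_eq (congrArg Multiset.prod (Multiset.map_congr rfl fun ρ _ => ?_))
  simp only [Function.comp_apply, eval_add, eval_mul, eval_C, eval_map, eval₂_at_apply, map_add,
    map_mul]
  ring

/-! ### The perturbation and its derivatives. -/

/-- The polynomial `∑ a_j t ^ (j + 1)` without constant term. -/
noncomputable def perturbation {E : Type*} [CommRing E] {m : ℕ} (a : Fin m → E) : E[X] :=
  ∑ j, C (a j) * X ^ (j.1 + 1)

section Perturbation
variable {E : Type*} [CommRing E]

theorem natDegree_perturbation_le {m : ℕ} (a : Fin m → E) : (perturbation a).natDegree ≤ m :=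
  natDegree_sum_le_of_forall_le _ _ fun j _ => (natDegree_C_mul_X_pow_le _ _).trans j.2

theorem perturbation_map {S : Type*} [CommRing S] (φ : E →+* S) {m : ℕ} (a : Fin m → E) :
    (perturbation a).map φ = perturbation fun j => φ (a j) := by
  simp [perturbation, Polynomial.map_sum]

theorem eval_perturbation {m : ℕ} (a : Fin m → E) (s : E) :
    (perturbation a).eval s = ∑ j, a j * s ^ (j.1 + 1) := by
  simp [perturbation, eval_finsetSum]

theorem eval_derivative_perturbation {m : ℕ} (a : Fin m → E) (s : E) :
    (derivative (perturbation a)).eval s = ∑ j, (j.1 + 1) * a j * s ^ j.1 := by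
  simp only [perturbation, derivative_sum, derivative_C_mul_X_pow, eval_finsetSum, eval_mul,
    eval_C, eval_pow, eval_X, Nat.add_sub_cancel]
  exact Finset.sum_congr rfl fun j _ => by push_cast; ring

theorem eval_derivative_derivative_perturbation {k : ℕ} (a : Fin (k + 2) → E) (s : E) :
    (derivative (derivative (perturbation a))).eval s =
      2 * a 1 + ∑ j : Fin k, (j.1 + 3) * (j.1 + 2) * a j.succ.succ * s ^ (j.1 + 1) := by
  simp only [perturbation, derivative_sum, derivative_C_mul_X_pow, eval_finsetSum, eval_mul,
    eval_C, eval_pow, eval_X, Nat.add_sub_cancel]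
  rw [Fin.sum_univ_succ, Fin.sum_univ_succ, Fin.succ_zero_eq_one]
  simp only [Fin.val_zero, Fin.val_one, Fin.val_succ]
  simp only [Nat.cast_zero, mul_zero, zero_mul, zero_add, Nat.sub_self, pow_zero]
  congr 1
  · norm_num; ring
  · exact Finset.sum_congr rfl fun j _ => by push_cast; ring

end Perturbation

/-! ### Recovering coefficients, and fields too small to contain them. -/

section Independence
variable {F E : Type*} [Field F] [Field E] [Algebra F E]

theorem IntermediateField.aeval_mem_of_mem (M : IntermediateField F E) {s : E} (hs : s ∈ M)
    (p : F[X]) : aeval s p ∈ M := by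
  have h := (aeval (⟨s, hs⟩ : M) p).2
  rwa [coe_aeval_mk_apply] at h

theorem mem_of_eval_derivative_mem {m : ℕ} (a : Fin (m + 1) → E) (M : IntermediateField F E)
    (ha : ∀ j : Fin m, a j.succ ∈ M) {s : E} (hs : s ∈ M)
    (h : (derivative (perturbation a)).eval s ∈ M) : a 0 ∈ M := by
  rw [eval_derivative_perturbation, Fin.sum_univ_succ] at h
  have h' : ∑ j : Fin m, ((j.succ.1 : E) + 1) * a j.succ * s ^ j.succ.1 ∈ M :=
    sum_mem fun j _ => mul_mem (mul_mem (add_mem (natCast_mem M _) (one_mem M)) (ha j))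
      (pow_mem hs _)
  simpa using sub_mem h h'

/-- In the second derivative `a 0` disappears and `a 1` occurs only in the constant term `2 * a 1`.
-/
theorem mem_of_eval_derivative_derivative_mem (h2 : (2 : E) ≠ 0) {k : ℕ} (a : Fin (k + 2) → E)
    (M : IntermediateField F E) (ha : ∀ j : Fin k, a j.succ.succ ∈ M) {s : E} (hs : s ∈ M)
    (h : (derivative (derivative (perturbation a))).eval s ∈ M) : a 1 ∈ M := by
  rw [eval_derivative_derivative_perturbation] at h
  have h' : ∑ j : Fin k, ((j.1 : E) + 3) * (j.1 + 2) * a j.succ.succ * s ^ (j.1 + 1) ∈ M :=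
    sum_mem fun j _ => mul_mem (mul_mem (mul_mem (add_mem (natCast_mem M _) (ofNat_mem M 3))
      (add_mem (natCast_mem M _) (ofNat_mem M 2))) (ha j)) (pow_mem hs _)
  have h3 := mul_mem (inv_mem (ofNat_mem M 2)) (sub_mem h h')
  rwa [add_sub_cancel_right, inv_mul_cancel_left₀ h2] at h3

/-- Subtracting the two values eliminates `a 0` and leaves `2 * a 1 * (s - t)` modulo `M`. -/
theorem mem_of_eval_derivative_mem_of_ne (h2 : (2 : E) ≠ 0) {k : ℕ} (a : Fin (k + 2) → E)
    (M : IntermediateField F E) (ha : ∀ j : Fin k, a j.succ.succ ∈ M) {s t : E} (hs : s ∈ M)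
    (ht : t ∈ M) (hst : s ≠ t) (h : (derivative (perturbation a)).eval s ∈ M)
    (h' : (derivative (perturbation a)).eval t ∈ M) : a 1 ∈ M := by
  have key : ∀ {x : E}, x ∈ M → (derivative (perturbation a)).eval x ∈ M →
      a 0 + 2 * a 1 * x ∈ M := by
    intro x hx h
    rw [eval_derivative_perturbation, Fin.sum_univ_succ, Fin.sum_univ_succ] at h
    have h' : ∑ j : Fin k, ((j.succ.succ.1 : E) + 1) * a j.succ.succ * x ^ j.succ.succ.1 ∈ M :=
      sum_mem fun j _ => mul_mem (mul_mem (add_mem (natCast_mem M _) (one_mem M)) (ha j))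
        (pow_mem hx _)
    have h3 := sub_mem h h'
    rw [← add_assoc, add_sub_cancel_right] at h3
    convert h3 using 2
    · simp
    · simp [one_add_one_eq_two]
  have h3 := mul_mem (inv_mem (mul_mem (ofNat_mem M 2) (sub_mem hs ht)))
    (sub_mem (key hs h) (key ht h'))
  convert h3 using 1
  have := sub_ne_zero.2 hst
  field_simp
  ring

theorem AlgebraicIndependent.exists_intermediateField_zero_notMem {m : ℕ} {a : Fin (m + 1) → E}
    (ha : AlgebraicIndependent F a) :
    ∃ M : IntermediateField F E, (∀ j : Fin m, a j.succ ∈ M) ∧ a 0 ∉ M := by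
  classical
  let s : Finset E := Finset.univ.image fun j : Fin m => a j.succ
  have hs : ∀ j : Fin m, a j.succ ∈ IntermediateField.adjoin F (s : Set E) := fun j =>
    IntermediateField.subset_adjoin F _ (by simp [s])
  refine ⟨IntermediateField.adjoin F (s : Set E), hs, fun h0 => ?_⟩
  have h := ha.card_le_of_mem_adjoin s (Fin.cases h0 hs)
  have h' : s.card ≤ m := Finset.card_image_le.trans (by simp)
  simp at h
  omega

/-- Take `M` generated by `x` and the last `k` variables: its transcendence degree is at most `k +
1`. -/
theorem AlgebraicIndependent.exists_intermediateField_mem {k : ℕ} {a : Fin (k + 2) → E}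
    (ha : AlgebraicIndependent F a) (x : E) :
    ∃ M : IntermediateField F E, x ∈ M ∧ (∀ j : Fin k, a j.succ.succ ∈ M) ∧
      ¬ (a 0 ∈ M ∧ a 1 ∈ M) := by
  classical
  let s : Finset E := insert x (Finset.univ.image fun j : Fin k => a j.succ.succ)
  have hs : ∀ j : Fin k, a j.succ.succ ∈ IntermediateField.adjoin F (s : Set E) := fun j =>
    IntermediateField.subset_adjoin F _ (by simp [s])
  refine ⟨IntermediateField.adjoin F (s : Set E),
    IntermediateField.subset_adjoin F _ (by simp [s]), hs, fun h01 => ?_⟩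
  have h := ha.card_le_of_mem_adjoin s (Fin.cases h01.1 (Fin.cases h01.2 hs))
  have h' : s.card ≤ k + 1 := (Finset.card_insert_le _ _).trans
    (Nat.succ_le_succ (Finset.card_image_le.trans (by simp)))
  simp at h
  omega

end Independence

/-! ### Critical points: transcendence, simplicity, existence. -/

section CriticalPoints
variable {F E : Type*} [Field F] [Field E] [Algebra F E] (f g : F[X])

/-- The numerator of the derivative of `f / g + ∑ a_j t ^ (j + 1)`. -/
noncomputable def genericCriticalPoly {m : ℕ} (a : Fin m → E) : E[X] :=
  criticalPoly (f.map (algebraMap F E)) (g.map (algebraMap F E)) (perturbation a)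

theorem eval_genericCriticalPoly {m : ℕ} (a : Fin m → E) (s : E) :
    (genericCriticalPoly f g a).eval s = aeval s (derivative f) * aeval s g -
      aeval s f * aeval s (derivative g) +
      aeval s g ^ 2 * (derivative (perturbation a)).eval s := by
  simp [genericCriticalPoly, criticalPoly, derivative_map, eval_map_algebraMap]

theorem eval_derivative_genericCriticalPoly {m : ℕ} (a : Fin m → E) (s : E) :
    (derivative (genericCriticalPoly f g a)).eval s =
      aeval s (derivative (derivative f)) * aeval s g -
      aeval s f * aeval s (derivative (derivative g)) +
      2 * aeval s g * aeval s (derivative g) * (derivative (perturbation a)).eval s +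
      aeval s g ^ 2 * (derivative (derivative (perturbation a))).eval s := by
  simp [genericCriticalPoly, criticalPoly, derivative_map, eval_map_algebraMap, derivative_pow]
  ring

variable {f g}

theorem eval_derivative_perturbation_mem {m : ℕ} {a : Fin m → E} (M : IntermediateField F E)
    {s : E} (hs : s ∈ M) (hg : aeval s g ≠ 0) (h : (genericCriticalPoly f g a).eval s ∈ M) :
    (derivative (perturbation a)).eval s ∈ M := by
  have hm := fun p : F[X] => M.aeval_mem_of_mem hs p
  rw [eval_genericCriticalPoly] at h
  have h1 := div_mem (sub_mem h (sub_mem (mul_mem (hm (derivative f)) (hm g))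
    (mul_mem (hm f) (hm (derivative g))))) (pow_mem (hm g) 2)
  rwa [add_sub_cancel_left, mul_div_cancel_left₀ _ (pow_ne_zero 2 hg)] at h1

theorem eval_derivative_derivative_perturbation_mem {m : ℕ} {a : Fin m → E}
    (M : IntermediateField F E) {s : E} (hs : s ∈ M) (hg : aeval s g ≠ 0)
    (h : (derivative (perturbation a)).eval s ∈ M)
    (h' : (derivative (genericCriticalPoly f g a)).eval s ∈ M) :
    (derivative (derivative (perturbation a))).eval s ∈ M := by
  have hm := fun p : F[X] => M.aeval_mem_of_mem hs p
  rw [eval_derivative_genericCriticalPoly] at h'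
  have h1 := div_mem (sub_mem h' (add_mem (sub_mem (mul_mem (hm (derivative (derivative f))) (hm g))
    (mul_mem (hm f) (hm (derivative (derivative g))))) (mul_mem (mul_mem (mul_mem (ofNat_mem M 2)
      (hm g)) (hm (derivative g))) h))) (pow_mem (hm g) 2)
  rwa [add_sub_cancel_left, mul_div_cancel_left₀ _ (pow_ne_zero 2 hg)] at h1

/-- A root in F would make W(s) = 0 a relation expressing `a 0` through the other variables. -/
theorem transcendental_of_isRoot_genericCriticalPoly [IsAlgClosed F] {m : ℕ} {a : Fin (m + 1) → E}
    (ha : AlgebraicIndependent F a) {s : E} (hs : (genericCriticalPoly f g a).eval s = 0)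
    (hg : aeval s g ≠ 0) : Transcendental F s := by
  intro halg
  obtain ⟨c, rfl⟩ := halg.mem_range_algebraMap
  obtain ⟨M, hM, hM0⟩ := ha.exists_intermediateField_zero_notMem
  have hc : algebraMap F E c ∈ M := M.algebraMap_mem c
  exact hM0 (mem_of_eval_derivative_mem a M hM hc
    (eval_derivative_perturbation_mem M hc hg (hs ▸ zero_mem M)))

/-- At a double root, W' = 0 yields `a 1` and then W = 0 yields `a 0`, both in the field generated
by `s` and the remaining variables. -/
theorem eval_derivative_genericCriticalPoly_ne_zero (h2 : (2 : E) ≠ 0) {k : ℕ}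
    {a : Fin (k + 2) → E} (ha : AlgebraicIndependent F a) {s : E}
    (hs : (genericCriticalPoly f g a).eval s = 0) (hg : aeval s g ≠ 0) :
    (derivative (genericCriticalPoly f g a)).eval s ≠ 0 := by
  intro hs'
  obtain ⟨M, hsM, hM, hM'⟩ := ha.exists_intermediateField_mem s
  have h1 := eval_derivative_perturbation_mem M hsM hg (hs ▸ zero_mem M)
  have ha1 := mem_of_eval_derivative_derivative_mem h2 a M hM hsM
    (eval_derivative_derivative_perturbation_mem M hsM hg h1 (hs' ▸ zero_mem M))
  exact hM' ⟨mem_of_eval_derivative_mem a M (Fin.cases ha1 hM) hsM h1, ha1⟩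

theorem genericCriticalPoly_ne_zero [IsAlgClosed F] (hg : g ≠ 0) {m : ℕ} {a : Fin (m + 1) → E}
    (ha : AlgebraicIndependent F a) : genericCriticalPoly f g a ≠ 0 := by
  intro h0
  obtain ⟨c, hc⟩ := exists_eval_ne_zero_of_natDegree_lt_card g hg
    (lt_of_lt_of_le (Cardinal.natCast_lt_aleph0) (Cardinal.aleph0_le_mk F))
  refine transcendental_of_isRoot_genericCriticalPoly (f := f) (g := g) ha
    (s := algebraMap F E c) (by simp [h0]) ?_ (isAlgebraic_algebraMap c)
  rw [aeval_algebraMap_apply_eq_algebraMap_eval]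
  simpa using hc

/-- If all roots of W were zeros of g, they would lie in F, so W would be its leading coefficient
times a polynomial over F. Its values at two points of F would then determine `a 0` and `a 1` from
that coefficient and the remaining variables. -/
theorem exists_isRoot_genericCriticalPoly [IsAlgClosed F] [IsAlgClosed E] (h2 : (2 : E) ≠ 0)
    (hg : g ≠ 0) {k : ℕ} {a : Fin (k + 2) → E} (ha : AlgebraicIndependent F a) :
    ∃ s ∈ (genericCriticalPoly f g a).roots, aeval s g ≠ 0 := by
  by_contra! H
  set W := genericCriticalPoly f g a with hW
  obtain ⟨M, hlM, hM, hM'⟩ := ha.exists_intermediateField_mem W.leadingCoeff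
  have hroot : ∀ ρ ∈ W.roots, ρ ∈ M := by
    intro ρ hρ
    obtain ⟨c, rfl⟩ := IsAlgebraic.mem_range_algebraMap ⟨g, hg, H ρ hρ⟩
    exact M.algebraMap_mem c
  have hev : ∀ c : F, W.eval (algebraMap F E c) ∈ M := by
    intro c
    rw [(IsAlgClosed.splits W).eq_prod_roots, eval_mul, eval_C, eval_multiset_prod]
    refine mul_mem hlM (multiset_prod_mem _ fun x hx => ?_)
    simp only [Multiset.map_map, Multiset.mem_map] at hx
    obtain ⟨ρ, hρ, rfl⟩ := hx
    simpa using sub_mem (M.algebraMap_mem c) (hroot ρ hρ)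
  obtain ⟨c, hc⟩ := exists_eval_ne_zero_of_natDegree_lt_card g hg
    (lt_of_lt_of_le (Cardinal.natCast_lt_aleph0) (Cardinal.aleph0_le_mk F))
  obtain ⟨d, hd⟩ := exists_eval_ne_zero_of_natDegree_lt_card (g * (X - C c))
    (mul_ne_zero hg (X_sub_C_ne_zero c))
    (lt_of_lt_of_le (Cardinal.natCast_lt_aleph0) (Cardinal.aleph0_le_mk F))
  have hmem : ∀ c : F, g.eval c ≠ 0 →
      (derivative (perturbation a)).eval (algebraMap F E c) ∈ M := fun c hc =>
    eval_derivative_perturbation_mem (f := f) (g := g) M (M.algebraMap_mem c)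
      (by rw [aeval_algebraMap_apply_eq_algebraMap_eval]; simpa using hc) (hev c)
  simp only [eval_mul, eval_sub, eval_X, eval_C, mul_ne_zero_iff, sub_ne_zero] at hd
  have ha1 := mem_of_eval_derivative_mem_of_ne h2 a M hM (M.algebraMap_mem c) (M.algebraMap_mem d)
    (fun h => hd.2 ((algebraMap F E).injective h).symm) (hmem c hc) (hmem d hd.1)
  exact hM' ⟨mem_of_eval_derivative_mem a M (Fin.cases ha1 hM) (M.algebraMap_mem c) (hmem c hc),
    ha1⟩

end CriticalPoints

/-! ### Base change and separability. -/

theorem discr_map_of_injective {R S : Type*} [CommRing R] [CommRing S] [IsDomain S] (φ : R →+* S)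
    (hφ : Function.Injective φ) {p : R[X]} (hp : 0 < p.natDegree) :
    (p.map φ).discr = φ p.discr := by
  have hn : (p.map φ).natDegree = p.natDegree := natDegree_map_eq_of_injective hφ p
  have hl : (p.map φ).leadingCoeff = φ p.leadingCoeff := leadingCoeff_map_of_injective hφ p
  have h1 := resultant_deriv (natDegree_pos_iff_degree_pos.1 hp)
  have h2 := resultant_deriv (f := p.map φ) (natDegree_pos_iff_degree_pos.1 (hn.symm ▸ hp))
  rw [derivative_map, hn, hl, resultant_map_map, h1] at h2
  simp only [map_mul, map_pow, map_neg, map_one] at h2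
  refine (mul_left_cancel₀ (mul_ne_zero (pow_ne_zero _ (neg_ne_zero.2 one_ne_zero)) ?_) h2).symm
  rw [map_ne_zero_iff φ hφ, leadingCoeff_ne_zero]
  rintro rfl
  simp at hp

theorem genericCriticalPoly_map {F K E : Type*} [Field F] [Field K] [Field E] [Algebra F K]
    [Algebra F E] [Algebra K E] [IsScalarTower F K E] (f g : F[X]) {m : ℕ} (a : Fin m → K) :
    (genericCriticalPoly f g a).map (algebraMap K E) =
      genericCriticalPoly f g fun j => algebraMap K E (a j) := by
  rw [genericCriticalPoly, ← criticalPoly_map, perturbation_map, map_map, map_map,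
    ← IsScalarTower.algebraMap_eq, genericCriticalPoly]

/-- If the minimal polynomial had zero derivative, the derivative of any multiple of it would vanish
at `s`. -/
theorem isSeparable_of_eval_derivative_ne_zero {K E : Type*} [Field K] [Field E] [Algebra K E]
    (p : K[X]) {s : E} (hs : aeval s p = 0) (hs' : aeval s (derivative p) ≠ 0) :
    IsSeparable K s := by
  have hp : p ≠ 0 := by rintro rfl; simp at hs'
  have hint : IsIntegral K s := (show IsAlgebraic K s from ⟨p, hp, hs⟩).isIntegral
  refine (separable_iff_derivative_ne_zero (minpoly.irreducible hint)).2 fun h0 => hs' ?_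
  obtain ⟨q, hq⟩ := minpoly.dvd K s hs
  rw [hq, derivative_mul, h0]
  simp [minpoly.aeval]

/-- The critical value `-α` of `f / g + ∑ a_j t ^ (j + 1)` at `τ` determines `τ`: it has derivative
`τ` with respect to `a₀`. -/
theorem exists_derivation_apply_eq_neg {F T E : Type*} [Field F] [Field T] [Field E] [Algebra F T]
    [Algebra F E] [Algebra T E] [IsScalarTower F T E] (D : Derivation F T T) {m : ℕ}
    (b : Fin (m + 1) → T) (h0 : D (b 0) = 1) (hs : ∀ j : Fin m, D (b j.succ) = 0) {f g : F[X]}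
    {τ : T} {α : E} (hg : aeval (algebraMap T E τ) g ≠ 0)
    (hP : aeval (algebraMap T E τ) f + aeval (algebraMap T E τ) g *
      ((perturbation fun j => algebraMap T E (b j)).eval (algebraMap T E τ) + α) = 0)
    (hW : (genericCriticalPoly f g fun j => algebraMap T E (b j)).eval (algebraMap T E τ) = 0) :
    ∃ β : T, algebraMap T E β = α ∧ D β = -τ := by
  have hinj := (algebraMap T E).injective
  rw [← perturbation_map, eval_map_algebraMap, aeval_algebraMap_apply, aeval_algebraMap_apply,
    aeval_algebraMap_apply, coe_aeval_eq_eval] at hP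
  rw [← genericCriticalPoly_map, eval_map_algebraMap, aeval_algebraMap_apply, coe_aeval_eq_eval,
    map_eq_zero_iff _ hinj] at hW
  rw [aeval_algebraMap_apply, map_ne_zero_iff _ hinj] at hg
  have hα : algebraMap T E (-(aeval τ f / aeval τ g) - (perturbation b).eval τ) = α := by
    have hg' : algebraMap T E (aeval τ g) ≠ 0 := (map_ne_zero_iff _ hinj).2 hg
    rw [map_sub, map_neg, map_div₀]
    field_simp
    linear_combination -hP
  refine ⟨_, hα, D.apply_eq_neg_of_critical b h0 hs f g τ _ hg ?_ ?_⟩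
  · rw [← eval_perturbation]
    field_simp
    ring
  · rw [← eval_derivative_perturbation, ← eval_genericCriticalPoly, hW]

/-! ### Critical values determine critical points. -/

section Generic
variable (F : Type*) [Field F] (m : ℕ)

/-- The variable `A_{j+1}` in the algebraic closure of `F(A₁, …, A_m)`. -/
noncomputable def closureVar (j : Fin m) : AlgebraicClosure (CoeffField F m) :=
  algebraMap (CoeffField F m) _ (algebraMap (MvPolynomial (Fin m) F) _ (MvPolynomial.X j))

theorem algebraicIndependent_closureVar : AlgebraicIndependent F (closureVar F m) := by
  have h := MvPolynomial.algebraicIndependent_X (Fin m) F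
  exact h.map' (f := (IsScalarTower.toAlgHom F (CoeffField F m)
    (AlgebraicClosure (CoeffField F m))).comp
      (IsScalarTower.toAlgHom F (MvPolynomial (Fin m) F) (CoeffField F m)))
    ((algebraMap (CoeffField F m) (AlgebraicClosure (CoeffField F m))).injective.comp
      (IsFractionRing.injective (MvPolynomial (Fin m) F) (CoeffField F m)))

variable {F m}

theorem two_ne_zero_closure (h2 : (2 : F) ≠ 0) : (2 : AlgebraicClosure (CoeffField F m)) ≠ 0 := by
  rw [← map_ofNat (algebraMap F (AlgebraicClosure (CoeffField F m))) 2]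
  exact (map_ne_zero_iff _ (algebraMap F _).injective).2 h2

theorem isSeparable_of_isRoot_genericCriticalPoly (h2 : (2 : F) ≠ 0) (hm : 2 ≤ m) {f g : F[X]}
    {τ : AlgebraicClosure (CoeffField F m)}
    (hτ : (genericCriticalPoly f g (closureVar F m)).eval τ = 0) (hg : aeval τ g ≠ 0) :
    IsSeparable (CoeffField F m) τ := by
  obtain ⟨k, rfl⟩ := Nat.exists_eq_add_of_le' hm
  have hτ' := eval_derivative_genericCriticalPoly_ne_zero (two_ne_zero_closure h2)
    (algebraicIndependent_closureVar F (k + 2)) hτ hg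
  have hmap := genericCriticalPoly_map (E := AlgebraicClosure (CoeffField F (k + 2))) f g
    fun j => algebraMap (MvPolynomial (Fin (k + 2)) F) (CoeffField F (k + 2)) (MvPolynomial.X j)
  change _ = genericCriticalPoly f g (closureVar F (k + 2)) at hmap
  rw [← hmap] at hτ hτ'
  rw [derivative_map, eval_map_algebraMap] at hτ'
  rw [eval_map_algebraMap] at hτ
  exact isSeparable_of_eval_derivative_ne_zero _ hτ hτ'

theorem critical_point_eq_of_value_eq (h2 : (2 : F) ≠ 0) (hm : 2 ≤ m) {f₁ g₁ f₂ g₂ : F[X]}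
    {τ₁ τ₂ α : AlgebraicClosure (CoeffField F m)}
    (hW₁ : (genericCriticalPoly f₁ g₁ (closureVar F m)).eval τ₁ = 0) (hg₁ : aeval τ₁ g₁ ≠ 0)
    (hP₁ : aeval τ₁ f₁ + aeval τ₁ g₁ * ((perturbation (closureVar F m)).eval τ₁ + α) = 0)
    (hW₂ : (genericCriticalPoly f₂ g₂ (closureVar F m)).eval τ₂ = 0) (hg₂ : aeval τ₂ g₂ ≠ 0)
    (hP₂ : aeval τ₂ f₂ + aeval τ₂ g₂ * ((perturbation (closureVar F m)).eval τ₂ + α) = 0) :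
    τ₁ = τ₂ := by
  have hs₁ := isSeparable_of_isRoot_genericCriticalPoly h2 hm hW₁ hg₁
  have hs₂ := isSeparable_of_isRoot_genericCriticalPoly h2 hm hW₂ hg₂
  obtain ⟨k, rfl⟩ := Nat.exists_eq_add_of_le' hm
  let T := separableClosure (CoeffField F (k + 2)) (AlgebraicClosure (CoeffField F (k + 2)))
  -- Localization followed by a separable extension is formally étale, so derivations of the
  -- polynomial ring extend to `T`.
  have : Algebra.FormallyEtale (MvPolynomial (Fin (k + 2)) F) (CoeffField F (k + 2)) :=
    Algebra.FormallyEtale.of_isLocalization (nonZeroDivisors (MvPolynomial (Fin (k + 2)) F))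
  have : Algebra.FormallyEtale (CoeffField F (k + 2)) T := Algebra.FormallyEtale.of_isSeparable _ _
  have : Algebra.FormallyEtale (MvPolynomial (Fin (k + 2)) F) T :=
    Algebra.FormallyEtale.comp _ (CoeffField F (k + 2)) _
  have : IsScalarTower F (MvPolynomial (Fin (k + 2)) F) T :=
    IsScalarTower.of_algebraMap_eq fun x => Subtype.ext <| by
      change algebraMap F (AlgebraicClosure (CoeffField F (k + 2))) x =
        algebraMap (CoeffField F (k + 2)) _
          (algebraMap (MvPolynomial (Fin (k + 2)) F) _ (algebraMap F _ x))
      rw [← IsScalarTower.algebraMap_apply, ← IsScalarTower.algebraMap_apply]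
  have : IsScalarTower F T (AlgebraicClosure (CoeffField F (k + 2))) :=
    IsScalarTower.of_algebraMap_eq fun x => rfl
  -- `D` extends ∂/∂A₁: index `0` is the coefficient of t.
  obtain ⟨D, hD⟩ := MvPolynomial.exists_derivation_of_formallyEtale (F := F) (T := T)
    (Pi.single (0 : Fin (k + 2)) 1)
  let b : Fin (k + 2) → T := fun j => algebraMap (MvPolynomial (Fin (k + 2)) F) T (MvPolynomial.X j)
  have hb : (fun j => algebraMap T (AlgebraicClosure (CoeffField F (k + 2))) (b j)) =
      closureVar F (k + 2) := rfl
  have hb0 : D (b 0) = 1 := by simp [b, hD]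
  have hbs : ∀ j : Fin (k + 1), D (b j.succ) = 0 := fun j => by simp [b, hD]
  rw [← hb] at hW₁ hW₂ hP₁ hP₂
  obtain ⟨β₁, hβ₁, h₁⟩ := exists_derivation_apply_eq_neg D b hb0 hbs
    (τ := (⟨τ₁, mem_separableClosure_iff.2 hs₁⟩ : T)) hg₁ hP₁ hW₁
  obtain ⟨β₂, hβ₂, h₂⟩ := exists_derivation_apply_eq_neg D b hb0 hbs
    (τ := (⟨τ₂, mem_separableClosure_iff.2 hs₂⟩ : T)) hg₂ hP₂ hW₂
  have hβ : β₁ = β₂ := (algebraMap T _).injective (hβ₁.trans hβ₂.symm)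
  rw [hβ, h₂] at h₁
  exact (Subtype.ext_iff.1 (neg_injective h₁)).symm

end Generic

/-! ### The discriminants of linear functions. -/

namespace LinearFunction
variable {F : Type*} [Field F] {m : ℕ}

theorem aeval_f_ne_zero {E : Type*} [Field E] [Algebra F E] {L : LinearFunction F}
    (hL : L.IsPrimitive) {s : E} (hg : aeval s L.g = 0) : aeval s L.f ≠ 0 := by
  obtain ⟨p, q, h⟩ := hL
  intro hf
  have := congrArg (aeval s) h
  simp [hf, hg] at this

/-- By primitivity `L₁.g` and `L₂.g` divide each other, so they differ by a constant. -/
theorem Proportional.of_mul_eq_mul {L₁ L₂ : LinearFunction F} (hL₁ : L₁.IsPrimitive)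
    (hL₂ : L₂.IsPrimitive) (h : L₁.f * L₂.g = L₂.f * L₁.g) : Proportional L₁ L₂ := by
  have h1 : L₁.g ∣ L₂.g := hL₁.symm.dvd_of_dvd_mul_left (h ▸ dvd_mul_left _ _)
  have h2 : L₂.g ∣ L₁.g := hL₂.symm.dvd_of_dvd_mul_left (h ▸ dvd_mul_left _ _)
  obtain ⟨u, hu⟩ := associated_of_dvd_dvd h1 h2
  obtain ⟨c, hc, hcu⟩ := isUnit_iff.1 u.isUnit
  have hg : L₂.g = C c * L₁.g := by rw [← hu, hcu, mul_comm]
  refine ⟨c, hc.ne_zero, mul_right_cancel₀ L₁.g_ne_zero ?_, hg⟩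
  rw [← h, hg]
  ring

/-- The factor of the discriminant contributed by a critical point `ρ`. -/
noncomputable def discrFactor (L : LinearFunction F) (m : ℕ)
    (ρ : AlgebraicClosure (CoeffField F m)) : (AlgebraicClosure (CoeffField F m))[X] :=
  C (aeval ρ L.f + aeval ρ L.g * (perturbation (closureVar F m)).eval ρ) + C (aeval ρ L.g) * X

theorem eval_discrFactor (L : LinearFunction F) (ρ α : AlgebraicClosure (CoeffField F m)) :
    (L.discrFactor m ρ).eval α =
      aeval ρ L.f + aeval ρ L.g * ((perturbation (closureVar F m)).eval ρ + α) := by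
  simp [discrFactor]
  ring

theorem aeval_g_ne_zero_of_eval_discrFactor {L : LinearFunction F} (hL : L.IsPrimitive)
    {ρ α : AlgebraicClosure (CoeffField F m)} (h : (L.discrFactor m ρ).eval α = 0) :
    aeval ρ L.g ≠ 0 := by
  intro hg
  rw [eval_discrFactor, hg, zero_mul, add_zero] at h
  exact aeval_f_ne_zero hL hg h

theorem evalAt_genericPoly_map (L : LinearFunction F) :
    (L.evalAt (genericPoly F m)).map
      (mapRingHom (algebraMap (CoeffField F m) (AlgebraicClosure (CoeffField F m)))) =
      (L.f.map (algebraMap F (AlgebraicClosure (CoeffField F m)))).map C +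
      (L.g.map (algebraMap F (AlgebraicClosure (CoeffField F m)))).map C *
        ((perturbation (closureVar F m)).map C + C X) := by
  have hcomp : (mapRingHom (algebraMap (CoeffField F m) (AlgebraicClosure (CoeffField F m)))).comp
      (algebraMap F (CoeffRing F m)) =
      (C : _ →+* (AlgebraicClosure (CoeffField F m))[X]).comp (algebraMap F _) := by
    ext x
    rw [RingHom.comp_apply, RingHom.comp_apply, Polynomial.algebraMap_apply, coe_mapRingHom,
      map_C, ← IsScalarTower.algebraMap_apply]
  have hgen : (genericPoly F m).map
      (mapRingHom (algebraMap (CoeffField F m) (AlgebraicClosure (CoeffField F m)))) =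
      (perturbation (closureVar F m)).map C + C X := by
    rw [genericPoly, Fin.sum_univ_succ, perturbation_map, perturbation, add_comm]
    simp [genericCoeff, Polynomial.map_sum, closureVar]
  rw [evalAt, Polynomial.map_add, Polynomial.map_mul, hgen, map_map, map_map, hcomp, map_map,
    map_map]

theorem map_genericDiscr (L : LinearFunction F) (hdeg : L.g.natDegree + m < L.f.natDegree) :
    (L.genericDiscr m).map (algebraMap (CoeffField F m) (AlgebraicClosure (CoeffField F m))) =
      ((L.f.map (algebraMap F (AlgebraicClosure (CoeffField F m)))).map C +
      (L.g.map (algebraMap F (AlgebraicClosure (CoeffField F m)))).map C *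
        ((perturbation (closureVar F m)).map C + C X)).discr := by
  have hinj : Function.Injective (mapRingHom (algebraMap (CoeffField F m)
      (AlgebraicClosure (CoeffField F m)))) := map_injective _ <|
    FaithfulSMul.algebraMap_injective (CoeffField F m) (AlgebraicClosure (CoeffField F m))
  have hP := L.evalAt_genericPoly_map (m := m)
  have hpos : 0 < (L.evalAt (genericPoly F m)).natDegree := by
    rw [← natDegree_map_eq_of_injective hinj, hP, natDegree_add_mul_of_lt] <;>
      rw [natDegree_map_eq_of_injective C_injective, natDegree_map_eq_of_injective
        (algebraMap F _).injective]
    · omega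
    · rw [natDegree_add_C, natDegree_map_eq_of_injective C_injective,
        natDegree_map_eq_of_injective C_injective,
        natDegree_map_eq_of_injective (algebraMap F _).injective]
      have := natDegree_perturbation_le (closureVar F m)
      omega
  rw [← hP, discr_map_of_injective _ hinj hpos, genericDiscr, coe_mapRingHom]

theorem genericDiscr_associated [IsAlgClosed F] (hm : 2 ≤ m) (L : LinearFunction F)
    (hL : L.IsPrimitive) (hdeg : L.g.natDegree + m < L.f.natDegree) :
    Associated
      ((L.genericDiscr m).map (algebraMap (CoeffField F m) (AlgebraicClosure (CoeffField F m))))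
      ((genericCriticalPoly L.f L.g (closureVar F m)).roots.map (L.discrFactor m)).prod := by
  obtain ⟨k, rfl⟩ := Nat.exists_eq_add_of_le' hm
  rw [L.map_genericDiscr hdeg]
  have hW := genericCriticalPoly_ne_zero (f := L.f) L.g_ne_zero
    (algebraicIndependent_closureVar F (k + 2))
  have h := discr_associated_prod_roots (L.f.map (algebraMap F _)) (L.g.map (algebraMap F _))
    (perturbation (closureVar F (k + 2))) ((isCoprime_map _).2 hL) (by
      rw [natDegree_map_eq_of_injective (algebraMap F _).injective,
        natDegree_map_eq_of_injective (algebraMap F _).injective]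
      have := natDegree_perturbation_le (closureVar F (k + 2))
      omega) hW
  simp only [eval_map_algebraMap] at h
  exact h

/-- The roots of the discriminant are the critical values. -/
theorem exists_critical_point_of_eval_genericDiscr [IsAlgClosed F] (hm : 2 ≤ m)
    {L : LinearFunction F} (hL : L.IsPrimitive) (hdeg : L.g.natDegree + m < L.f.natDegree)
    {α : AlgebraicClosure (CoeffField F m)} (h : aeval α (L.genericDiscr m) = 0) :
    ∃ ρ, (genericCriticalPoly L.f L.g (closureVar F m)).eval ρ = 0 ∧
      (L.discrFactor m ρ).eval α = 0 := by
  rw [← eval_map_algebraMap] at h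
  have h' := (L.genericDiscr_associated hm hL hdeg).dvd
  have h0 := eval_eq_zero_of_dvd_of_eval_eq_zero h' h
  rw [eval_multiset_prod, Multiset.prod_eq_zero_iff, Multiset.map_map] at h0
  obtain ⟨ρ, hρ, hρ'⟩ := Multiset.mem_map.1 h0
  exact ⟨ρ, isRoot_of_mem_roots hρ, hρ'⟩

theorem not_isSquare_genericDiscr [IsAlgClosed F] (h2 : (2 : F) ≠ 0) (hm : 2 ≤ m)
    {L : LinearFunction F} (hL : L.IsPrimitive) (hdeg : L.g.natDegree + m < L.f.natDegree) :
    ¬ IsSquare (L.genericDiscr m) := by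
  classical
  rintro ⟨e, he⟩
  have hassoc := L.genericDiscr_associated hm hL hdeg
  obtain ⟨τ, hτ, hg⟩ : ∃ τ ∈ (genericCriticalPoly L.f L.g (closureVar F m)).roots,
      aeval τ L.g ≠ 0 := by
    obtain ⟨k, rfl⟩ := Nat.exists_eq_add_of_le' hm
    exact exists_isRoot_genericCriticalPoly (two_ne_zero_closure h2) L.g_ne_zero
      (algebraicIndependent_closureVar F (k + 2))
  have hτ0 : (genericCriticalPoly L.f L.g (closureVar F m)).eval τ = 0 := isRoot_of_mem_roots hτ
  set α := -(aeval τ L.f / aeval τ L.g) - (perturbation (closureVar F m)).eval τ with hα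
  have hτα : (L.discrFactor m τ).eval α = 0 := by
    rw [eval_discrFactor, hα]
    field_simp
    ring
  have hdegree : (L.discrFactor m τ).degree = 1 := by
    rw [discrFactor, add_comm]
    exact degree_linear hg
  have hprime : Prime (L.discrFactor m τ) := prime_of_degree_eq_one hdegree
  rw [he, Polynomial.map_mul, ← Multiset.cons_erase hτ, Multiset.map_cons, Multiset.prod_cons]
    at hassoc
  set d := L.discrFactor m τ with hd
  -- The prime `d` divides `e`, so its square divides the product; cancelling one `d` leaves `α` a
  -- root of another factor.
  have hde : d ∣ e.map (algebraMap (CoeffField F m) (AlgebraicClosure (CoeffField F m))) :=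
    (hprime.dvd_or_dvd ((dvd_mul_right _ _).trans hassoc.symm.dvd)).elim id id
  have hdd := (mul_dvd_mul hde hde).trans hassoc.dvd
  have hrest := (mul_dvd_mul_iff_left hprime.ne_zero).1 hdd
  have h0 := eval_eq_zero_of_dvd_of_eval_eq_zero hrest hτα
  rw [eval_multiset_prod, Multiset.prod_eq_zero_iff, Multiset.map_map] at h0
  obtain ⟨ρ, hρ, hρα⟩ := Multiset.mem_map.1 h0
  have hρ0 : (genericCriticalPoly L.f L.g (closureVar F m)).eval ρ = 0 :=
    isRoot_of_mem_roots (Multiset.mem_of_mem_erase hρ)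
  have hgρ := aeval_g_ne_zero_of_eval_discrFactor hL hρα
  rw [Function.comp_apply, eval_discrFactor] at hρα
  rw [hd, eval_discrFactor] at hτα
  obtain rfl := critical_point_eq_of_value_eq h2 hm hρ0 hgρ hρα hτ0 hg hτα
  -- The same critical point still occurs after one copy is erased, so it is a multiple root of W.
  have hcount : 1 < (genericCriticalPoly L.f L.g (closureVar F m)).rootMultiplicity ρ := by
    rw [← count_roots]
    have := Multiset.count_pos.2 hρ
    rw [Multiset.count_erase_self] at this
    omega
  have hW0 : genericCriticalPoly L.f L.g (closureVar F m) ≠ 0 := ne_zero_of_mem_roots hτ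
  have hder := ((one_lt_rootMultiplicity_iff_isRoot hW0).1 hcount).2
  obtain ⟨k, rfl⟩ := Nat.exists_eq_add_of_le' hm
  exact eval_derivative_genericCriticalPoly_ne_zero (two_ne_zero_closure h2)
    (algebraicIndependent_closureVar F (k + 2)) hτ0 hg hder

theorem isCoprime_genericDiscr [IsAlgClosed F] (h2 : (2 : F) ≠ 0) (hm : 2 ≤ m)
    {L₁ L₂ : LinearFunction F} (hL₁ : L₁.IsPrimitive) (hL₂ : L₂.IsPrimitive)
    (hdistinct : ¬ Proportional L₁ L₂) (hdeg₁ : L₁.g.natDegree + m < L₁.f.natDegree)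
    (hdeg₂ : L₂.g.natDegree + m < L₂.f.natDegree) :
    IsCoprime (L₁.genericDiscr m) (L₂.genericDiscr m) := by
  rw [isCoprime_iff_aeval_ne_zero_of_isAlgClosed _ (AlgebraicClosure (CoeffField F m))]
  by_contra! H
  obtain ⟨α, h₁, h₂⟩ := H
  obtain ⟨τ, hτ, hP₁⟩ := exists_critical_point_of_eval_genericDiscr hm hL₁ hdeg₁ h₁
  obtain ⟨ρ, hρ, hP₂⟩ := exists_critical_point_of_eval_genericDiscr hm hL₂ hdeg₂ h₂
  have hg₁ := aeval_g_ne_zero_of_eval_discrFactor hL₁ hP₁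
  have hg₂ := aeval_g_ne_zero_of_eval_discrFactor hL₂ hP₂
  rw [eval_discrFactor] at hP₁ hP₂
  obtain rfl := critical_point_eq_of_value_eq h2 hm hτ hg₁ hP₁ hρ hg₂ hP₂
  have htr : Transcendental F τ := by
    obtain ⟨k, rfl⟩ := Nat.exists_eq_add_of_le' hm
    exact transcendental_of_isRoot_genericCriticalPoly
      (algebraicIndependent_closureVar F (k + 2)) hτ hg₁
  refine hdistinct (Proportional.of_mul_eq_mul hL₁ hL₂ (transcendental_iff_injective.1 htr ?_))
  rw [map_mul, map_mul]
  -- The common term u(τ) + α cancels.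
  linear_combination aeval τ L₂.g * hP₁ - aeval τ L₁.g * hP₂

end LinearFunction

theorem proposition2p1 {F : Type*} [Field F] [IsAlgClosed F] (hchar : ringChar F ≠ 2)
    (m : ℕ) (hm : 2 ≤ m) (L₁ L₂ : LinearFunction F)
    (hL₁ : L₁.IsPrimitive) (hL₂ : L₂.IsPrimitive)
    (hdistinct : ¬ LinearFunction.Proportional L₁ L₂)
    (hdeg₁ : L₁.g.natDegree + m < L₁.f.natDegree)
    (hdeg₂ : L₂.g.natDegree + m < L₂.f.natDegree) :
    ¬ IsSquare (L₁.genericDiscr m) ∧ ¬ IsSquare (L₂.genericDiscr m) ∧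
      IsCoprime (L₁.genericDiscr m) (L₂.genericDiscr m) := by
  have h2 : (2 : F) ≠ 0 := Ring.two_ne_zero hchar
  exact ⟨LinearFunction.not_isSquare_genericDiscr h2 hm hL₁ hdeg₁,
    LinearFunction.not_isSquare_genericDiscr h2 hm hL₂ hdeg₂,
    LinearFunction.isCoprime_genericDiscr h2 hm hL₁ hL₂ hdistinct hdeg₁ hdeg₂⟩
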